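/- Let $G=(V,E)$ be a finite simple undirected graph with $n=|V|$ vertices, $m=|E|\ge 1$ edges, adjacency matrix $A$ and degrees $d_i$. The modularity of a partition $\mathcal C$ of $V$ is $$Q(\mathcal C)=\sum_{C\in\mathcal C}\Big(\frac{m_C}{m}-\Big(\frac{D_C}{2m}\Big)^2\Big),$$ where $m_C$ is the number of edges with both endpoints in $C$ and $D_C=\sum_{i\in C}d_i$; let $\mathsf{OPT}=\max_{\mathcal C}Q(\mathcal C)$. Put $q_{ij}=\frac{A_{ij}}{2m}-\frac{d_id_j}{4m^2}$ for $(i,j)\in V\times V$ and $q=\sum_{(i,j):\,q_{ij}\ge 0}q_{ij}$. Let $X^*=(x^*_{ij})$ be any optimal solution of the semidefinite program $$\text{maximize }\sum_{(i,j)\in V\times V}q_{ij}x_{ij}\quad\text{subject to } X=(x_{ij})\text{ symmetric positive semidefinite},\ x_{ii}=1,\ x_{ij}\ge 0\quad (i,j\in V),$$ and let $z^*_+=\frac1q\sum_{(i,j):\,q_{ij}\ge0}q_{ij}x^*_{ij}$. For positive integers $k$ and $x\in[0,1]$ let $$g_k(x)=x-\Big(1-\frac{\arccos x}{\pi}\Big)^k+\frac1{2^k},$$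 and let $k^*$ be any minimiser of $g_k(z^*_+)$ over $k\in\{1,\dots,\max\{3,\lceil\log_2 n\rceil\}\}$. Let $u_i\in\mathbb R^d$ $(i\in V)$ be any vectors with $u_i\cdot u_j=x^*_{ij}$ for all $i,j$. Choose $k^*$ independent uniformly random hyperplanes through the origin of $\mathbb R^d$ (say with independent standard Gaussian normal vectors), and let $\mathcal C_{k^*}$ be the partition of $V$ in which $i$ and $j$ are in the same class if and only if $u_i$ and $u_j$ lie on the same side of every one of these hyperplanes. Then $Q(\mathcal C_{k^*})$ is integrable and $$\mathrm E[Q(\mathcal C_{k^*})]\ \ge\ \mathsf{OPT}-q\left(\cos\Big(\frac{3-\sqrt5}{4}\pi\Big)-\frac{1+\sqrt5}{8}\right).$$ If moreover $\mathsf{OPT}\ge\cos\big(\frac{3-\sqrt5}{4}\pi\big)$, then $\min_{k\ge1}g_k(\mathsf{OPT})$ (over all positive integers $k$) is attained and $$\mathrm E[Q(\mathcal C_{k^*})]\ >\ \mathsf{OPT}-q\,\min_{k\in\mathbb Z_{>0}}g_k(\mathsf{OPT}).$$ Here $q<1$ and $\cos\big(\frac{3-\sqrt5}{4}\pi\big)-\frac{1+\sqrt5}{8}<0.42084$.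 -/

import Mathlib

open MeasureTheory ProbabilityTheory

namespace ModularityMax

noncomputable section

section Graph

variable {V : Type*} [Fintype V] [DecidableEq V]

/-- The modularity `Q(𝒞) = ∑_{C ∈ 𝒞} (m_C / m - (D_C / 2m)²)` of a partition `𝒞` of the vertex set,
where `m_C` is the number of edges with both endpoints in `C` and `D_C` is the sum of the degrees
of the vertices of `C`. -/
def modularity (G : SimpleGraph V) [DecidableRel G.Adj]
    (𝒞 : Finpartition (Finset.univ : Finset V)) : ℝ :=
  ∑ C ∈ 𝒞.parts,
    (((G.edgeFinset.filter (fun e => ∀ v ∈ e, v ∈ C)).card : ℝ) / (G.edgeFinset.card : ℝ)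
      - ((∑ v ∈ C, (G.degree v : ℝ)) / (2 * (G.edgeFinset.card : ℝ))) ^ 2)

/-- The largest modularity of a partition of the vertex set (a supremum over the finite,
nonempty set of partitions, hence a maximum). -/
def optModularity (G : SimpleGraph V) [DecidableRel G.Adj] : ℝ :=
  ⨆ 𝒞 : Finpartition (Finset.univ : Finset V), modularity G 𝒞

/-- `q_ij = A_ij / 2m - d_i d_j / 4m²`. -/
def qCoeff (G : SimpleGraph V) [DecidableRel G.Adj] (i j : V) : ℝ :=
  G.adjMatrix ℝ i j / (2 * (G.edgeFinset.card : ℝ))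
    - (G.degree i : ℝ) * (G.degree j : ℝ) / (4 * (G.edgeFinset.card : ℝ) ^ 2)

/-- The pairs `(i, j)` with `q_ij ≥ 0`. -/
def nonnegPairs (G : SimpleGraph V) [DecidableRel G.Adj] : Finset (V × V) :=
  Finset.univ.filter (fun p => 0 ≤ qCoeff G p.1 p.2)

/-- `q`, the sum of the nonnegative coefficients `q_ij`. -/
def qTotal (G : SimpleGraph V) [DecidableRel G.Adj] : ℝ :=
  ∑ p ∈ nonnegPairs G, qCoeff G p.1 p.2

/-- Feasible solutions of the modularity SDP. -/
def SDPFeasible (X : Matrix V V ℝ) : Prop :=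
  X.PosSemidef ∧ (∀ i, X i i = 1) ∧ ∀ i j, 0 ≤ X i j

/-- Objective function of the modularity SDP. -/
def sdpObjective (G : SimpleGraph V) [DecidableRel G.Adj] (X : Matrix V V ℝ) : ℝ :=
  ∑ p : V × V, qCoeff G p.1 p.2 * X p.1 p.2

/-- Optimal solutions of the modularity SDP. -/
def SDPOptimal (G : SimpleGraph V) [DecidableRel G.Adj] (X : Matrix V V ℝ) : Prop :=
  SDPFeasible X ∧ ∀ Y : Matrix V V ℝ, SDPFeasible Y → sdpObjective G Y ≤ sdpObjective G X

/-- `z₊ = (1/q) ∑_{q_ij ≥ 0} q_ij x_ij`. -/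
def zPlus (G : SimpleGraph V) [DecidableRel G.Adj] (X : Matrix V V ℝ) : ℝ :=
  (1 / qTotal G) * ∑ p ∈ nonnegPairs G, qCoeff G p.1 p.2 * X p.1 p.2

end Graph

/-- `f_k(x) = (1 - arccos(x)/π)^k`. -/
def f (k : ℕ) (x : ℝ) : ℝ := (1 - Real.arccos x / Real.pi) ^ k

/-- `g_k(x) = x - f_k(x) + 1/2^k`. -/
def g (k : ℕ) (x : ℝ) : ℝ := x - f k x + 1 / 2 ^ k

/-- The admissible numbers of hyperplanes `{1, …, max{3, ⌈log₂ n⌉}}`. -/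
def admissible (n : ℕ) : Finset ℕ := Finset.Icc 1 (max 3 ⌈Real.logb 2 (n : ℝ)⌉₊)

/-- `k ∈ argmin_{k ∈ {1, …, max{3, ⌈log₂ n⌉}}} g_k(x)`. -/
def IsArgminG (n : ℕ) (x : ℝ) (k : ℕ) : Prop :=
  k ∈ admissible n ∧ ∀ l ∈ admissible n, g k x ≤ g l x

section Rounding

variable {V : Type*} [Fintype V] [DecidableEq V] {d k : ℕ}

/-- Two vertices are equivalent if for every `t` their vectors lie on the same side of the
hyperplane through the origin with normal vector `r t`. -/
def sameSide (u : V → EuclideanSpace ℝ (Fin d)) (r : Fin k → EuclideanSpace ℝ (Fin d)) :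
    Setoid V where
  r i j := ∀ t, 0 ≤ inner ℝ (r t) (u i) ↔ 0 ≤ inner ℝ (r t) (u j)
  iseqv := ⟨fun _ _ => Iff.rfl, fun h t => (h t).symm, fun h₁ h₂ t => (h₁ t).trans (h₂ t)⟩

open Classical in
/-- The partition of the vertices cut out by the hyperplanes with normal vectors `r t`
(empty cells are omitted; they contribute `0` to the modularity). -/
def hyperplanePartition (u : V → EuclideanSpace ℝ (Fin d))
    (r : Fin k → EuclideanSpace ℝ (Fin d)) : Finpartition (Finset.univ : Finset V) :=
  Finpartition.ofSetoid (sameSide u r)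

/-- The law of the normal vectors of `k` independent uniformly random hyperplanes through the
origin of `ℝ^d`: independent standard Gaussian vectors (their directions are independent and
uniformly distributed on the unit sphere). -/
def hyperplaneLaw (d k : ℕ) : Measure (Fin k → EuclideanSpace ℝ (Fin d)) :=
  Measure.pi (fun _ : Fin k => stdGaussian (EuclideanSpace ℝ (Fin d)))

/-- Expected modularity of the partition obtained from the vectors `u` by `k` random
hyperplanes. -/
def expectedModularity (G : SimpleGraph V) [DecidableRel G.Adj]
    (u : V → EuclideanSpace ℝ (Fin d)) (k : ℕ) : ℝ :=
  ∫ r, modularity G (hyperplanePartition u r) ∂(hyperplaneLaw d k)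

end Rounding

end

end ModularityMax

/-! One random hyperplane leaves two unit vectors at angle θ together with probability 1 - θ/π, so
by independence and linearity the expected modularity is ∑ q_ij f_k(x_ij). The function f_k is
convex on [0,1]. On pairs with q_ij ≥ 0, Jensen's inequality bounds the sum below by q f_k(z₊). On
the other pairs f_k(x) ≤ x + 2^{-k} (chord), and their coefficients sum to -q because all the q_ij
sum to 0. Hence the expectation is at least the SDP value, itself at least OPT, minus q g_k(z₊)
(`sdpObjective_sub_le`).

Both guarantees now rest on the concavity of g_k. At c = cos((3-√5)π/4) the curves g_2 and g_3
cross, g_2 with nonnegative slope and g_3 with negative slope, so min(g_2, g_3) ≤ g_2(c) on all of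
[0,1] (`exists_g_le_crossing`).

For OPT ≥ c, the inequalities OPT ≤ q z₊ and q < 1 give OPT < z₊. A best index K for g_K(OPT) can be
chosen so that g_K has negative slope at OPT, whence g_K(z₊) < g_K(OPT). Since OPT ≤ 1 - 1/n, this K
is at most max{3, ⌈log₂ n⌉}, so the chosen k does at least as well (`exists_admissible_minimizer`).
-/

namespace ModularityMax

/-! ### Modularity as a quadratic form, and its relaxation. -/

section Graph

variable {V : Type*} [Fintype V] [DecidableEq V] (G : SimpleGraph V) [DecidableRel G.Adj]

omit [DecidableEq V] in
lemma sum_adjMatrix (i : V) : ∑ j, G.adjMatrix ℝ i j = G.degree i := by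
  simp [SimpleGraph.adjMatrix_apply, SimpleGraph.degree, SimpleGraph.neighborFinset_eq_filter]

/-- Handshake lemma for the subgraph `H` that keeps only the edges inside `C`. -/
lemma two_mul_card_edges_inside (C : Finset V) :
    2 * ((G.edgeFinset.filter (fun e => ∀ v ∈ e, v ∈ C)).card : ℝ)
      = ∑ i ∈ C, ∑ j ∈ C, G.adjMatrix ℝ i j := by
  classical
  let H : SimpleGraph V :=
    { Adj := fun i j => G.Adj i j ∧ i ∈ C ∧ j ∈ C
      symm := ⟨fun i j h => ⟨h.1.symm, h.2.2, h.2.1⟩⟩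
      loopless := ⟨fun i h => G.loopless.irrefl i h.1⟩ }
  have hE : H.edgeFinset = G.edgeFinset.filter (fun e => ∀ v ∈ e, v ∈ C) := by
    ext e
    induction e with
    | _ a b => simp [H]
  have h := H.sum_degrees_eq_twice_card_edges
  rw [← hE]
  have h2 : ((∑ v, H.degree v : ℕ) : ℝ) = 2 * (H.edgeFinset.card : ℝ) := by
    rw [h]; push_cast; rfl
  rw [← h2]
  push_cast
  have hA : ∀ i j, H.adjMatrix ℝ i j
      = if i ∈ C then (if j ∈ C then G.adjMatrix ℝ i j else 0) else 0 := by
    intro i j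
    simp only [SimpleGraph.adjMatrix_apply, H]
    by_cases hi : i ∈ C <;> by_cases hj : j ∈ C <;> simp [hi, hj]
  have hB : ∀ i, (∑ j, if i ∈ C then (if j ∈ C then G.adjMatrix ℝ i j else 0) else 0)
      = if i ∈ C then ∑ j ∈ C, G.adjMatrix ℝ i j else 0 := by
    intro i
    by_cases hi : i ∈ C <;> simp [hi]
  simp only [← sum_adjMatrix, hA, hB, Finset.sum_ite_mem, Finset.univ_inter]

/-- Each part contributes the coefficients of the ordered pairs inside it, and a pair lies in at
most one part. -/
lemma modularity_eq_sum (𝒞 : Finpartition (Finset.univ : Finset V)) :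
    modularity G 𝒞
      = ∑ p : V × V, qCoeff G p.1 p.2 * (if 𝒞.part p.1 = 𝒞.part p.2 then 1 else 0) := by
  have h1 : ∀ C ∈ 𝒞.parts,
      (((G.edgeFinset.filter (fun e => ∀ v ∈ e, v ∈ C)).card : ℝ) / (G.edgeFinset.card : ℝ)
        - ((∑ v ∈ C, (G.degree v : ℝ)) / (2 * (G.edgeFinset.card : ℝ))) ^ 2)
      = ∑ p : V × V, qCoeff G p.1 p.2 * (if 𝒞.part p.1 = C ∧ 𝒞.part p.2 = C then 1 else 0) := by
    intro C hC
    have hpart : ∀ i, 𝒞.part i = C ↔ i ∈ C := fun i => 𝒞.part_eq_iff_mem hC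
    simp only [hpart]
    rw [Fintype.sum_prod_type]
    have hs : ∀ i j, qCoeff G i j * (if i ∈ C ∧ j ∈ C then 1 else 0)
        = if i ∈ C then (if j ∈ C then qCoeff G i j else 0) else 0 := by
      intro i j
      by_cases hi : i ∈ C <;> by_cases hj : j ∈ C <;> simp [hi, hj]
    simp only [hs]
    have : ∀ i, (∑ j, if i ∈ C then (if j ∈ C then qCoeff G i j else 0) else 0)
        = if i ∈ C then ∑ j ∈ C, qCoeff G i j else 0 := by
      intro i
      by_cases hi : i ∈ C <;> simp [hi]
    simp only [this, Finset.sum_ite_mem, Finset.univ_inter]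
    simp only [qCoeff, Finset.sum_sub_distrib, ← Finset.sum_div, ← two_mul_card_edges_inside,
      ← Finset.mul_sum, ← Finset.sum_mul]
    -- Without edges every quotient is a division by 0, hence 0 on both sides.
    by_cases hm : (G.edgeFinset.card : ℝ) = 0
    · simp [hm]
    field_simp
    ring
  unfold modularity
  rw [Finset.sum_congr rfl h1, Finset.sum_comm]
  refine Finset.sum_congr rfl fun p _ => ?_
  rw [← Finset.mul_sum]
  congr 1
  have : ∀ C, (if 𝒞.part p.1 = C ∧ 𝒞.part p.2 = C then (1 : ℝ) else 0)
      = if 𝒞.part p.1 = C then (if 𝒞.part p.1 = 𝒞.part p.2 then 1 else 0) else 0 := by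
    intro C
    by_cases h1 : 𝒞.part p.1 = C <;> simp [h1, eq_comm]
  simp only [this, Finset.sum_ite_eq, (𝒞.part_mem).2 (Finset.mem_univ _), if_true]

variable {G}

omit [DecidableEq V] in
lemma sum_degree (G : SimpleGraph V) [DecidableRel G.Adj] :
    ∑ i, (G.degree i : ℝ) = 2 * (G.edgeFinset.card : ℝ) := by
  exact_mod_cast G.sum_degrees_eq_twice_card_edges

-- Every row sums to zero: both terms add up to d_i / 2m.
omit [DecidableEq V] in
lemma sum_qCoeff (hm : 0 < G.edgeFinset.card) : ∑ p : V × V, qCoeff G p.1 p.2 = 0 := by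
  have h : (0 : ℝ) < G.edgeFinset.card := by exact_mod_cast hm
  rw [Fintype.sum_prod_type]
  refine Finset.sum_eq_zero fun i _ => ?_
  change ∑ j, qCoeff G i j = 0
  simp only [qCoeff, Finset.sum_sub_distrib]
  rw [← Finset.sum_div, sum_adjMatrix, ← Finset.sum_div,
    ← Finset.mul_sum, sum_degree]
  field_simp
  ring

omit [DecidableEq V] in
lemma exists_degree_pos (hm : 0 < G.edgeFinset.card) : ∃ i, 0 < G.degree i := by
  by_contra! h
  have h1 := G.sum_degrees_eq_twice_card_edges
  rw [Finset.sum_eq_zero fun i _ => Nat.le_zero.1 (h i)] at h1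
  omega

lemma sum_qCoeff_neg (hm : 0 < G.edgeFinset.card) :
    ∑ p ∈ (nonnegPairs G)ᶜ, qCoeff G p.1 p.2 = -qTotal G := by
  have := Finset.sum_add_sum_compl (nonnegPairs G) (fun p => qCoeff G p.1 p.2)
  rw [sum_qCoeff hm] at this
  unfold qTotal
  linarith

omit [DecidableEq V] in
lemma mem_nonnegPairs {p : V × V} : p ∈ nonnegPairs G ↔ 0 ≤ qCoeff G p.1 p.2 := by
  simp [nonnegPairs]

/-- A vertex of positive degree has a negative diagonal coefficient, and the positive mass balances
the negative mass. -/
lemma qTotal_pos (hm : 0 < G.edgeFinset.card) : 0 < qTotal G := by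
  have h : (0 : ℝ) < G.edgeFinset.card := by exact_mod_cast hm
  obtain ⟨i, hi⟩ := exists_degree_pos hm
  have hi' : (0 : ℝ) < G.degree i := by exact_mod_cast hi
  have hq : qCoeff G i i < 0 := by
    simp only [qCoeff, SimpleGraph.adjMatrix_apply, G.irrefl, if_false, zero_div, zero_sub]
    rw [neg_lt_zero]; positivity
  have h2 : ∑ p ∈ (nonnegPairs G)ᶜ, qCoeff G p.1 p.2 < 0 := by
    refine Finset.sum_neg' (fun p hp => ?_) ⟨(i, i), ?_, hq⟩
    · rw [Finset.mem_compl, mem_nonnegPairs, not_le] at hp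
      exact hp.le
    · rw [Finset.mem_compl, mem_nonnegPairs, not_le]; exact hq
  rw [sum_qCoeff_neg hm] at h2
  linarith

omit [DecidableEq V] in
lemma exists_adj (hm : 0 < G.edgeFinset.card) : ∃ i j, G.Adj i j := by
  obtain ⟨i, hi⟩ := exists_degree_pos hm
  exact ⟨i, (G.degree_pos_iff_exists_adj i).1 hi⟩

/-- The numbers A_ij / 2m sum to 1 and dominate the q_ij, strictly at an edge. -/
lemma qTotal_lt_one (hm : 0 < G.edgeFinset.card) : qTotal G < 1 := by
  have h : (0 : ℝ) < G.edgeFinset.card := by exact_mod_cast hm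
  have hA : ∑ p : V × V, G.adjMatrix ℝ p.1 p.2 / (2 * (G.edgeFinset.card : ℝ)) = 1 := by
    rw [Fintype.sum_prod_type]
    simp only [← Finset.sum_div, sum_adjMatrix, sum_degree]
    field_simp
  rw [← hA, qTotal, nonnegPairs, Finset.sum_filter]
  have hA0 : ∀ p : V × V, 0 ≤ G.adjMatrix ℝ p.1 p.2 / (2 * (G.edgeFinset.card : ℝ)) := by
    intro p
    rw [SimpleGraph.adjMatrix_apply]
    split_ifs <;> positivity
  have hq : ∀ p : V × V, qCoeff G p.1 p.2 ≤ G.adjMatrix ℝ p.1 p.2 / (2 * (G.edgeFinset.card : ℝ)) :=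
    fun p => sub_le_self _ (by positivity)
  obtain ⟨i, j, hij⟩ := exists_adj hm
  refine Finset.sum_lt_sum (fun p _ => ?_) ⟨(i, j), Finset.mem_univ _, ?_⟩
  · split_ifs
    · exact hq p
    · exact hA0 p
  · have hi : (0 : ℝ) < G.degree i := by
      exact_mod_cast (G.degree_pos_iff_exists_adj i).2 ⟨j, hij⟩
    have hj : (0 : ℝ) < G.degree j := by
      exact_mod_cast (G.degree_pos_iff_exists_adj j).2 ⟨i, hij.symm⟩
    split_ifs
    · exact sub_lt_self _ (by positivity)
    · rw [SimpleGraph.adjMatrix_apply, if_pos hij]; positivity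

/-- Cauchy–Schwarz: the fractions D_C / 2m sum to 1 over at most n parts, so their squares sum to at
least 1/n. This is what later bounds the best number of hyperplanes by log₂ n. -/
lemma modularity_le (hm : 0 < G.edgeFinset.card) (𝒞 : Finpartition (Finset.univ : Finset V)) :
    modularity G 𝒞 ≤ 1 - 1 / (Fintype.card V : ℝ) := by
  have h : (0 : ℝ) < G.edgeFinset.card := by exact_mod_cast hm
  set m : ℝ := (G.edgeFinset.card : ℝ) with hmdef
  have hparts : (𝒞.parts.card : ℝ) ≤ Fintype.card V := by
    exact_mod_cast 𝒞.card_parts_le_card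
  have hV : (0 : ℝ) < Fintype.card V := by
    obtain ⟨i, _⟩ := exists_adj hm
    exact_mod_cast Fintype.card_pos_iff.2 ⟨i⟩
  have hD : ∑ C ∈ 𝒞.parts, (∑ v ∈ C, (G.degree v : ℝ)) / (2 * m) = 1 := by
    have h := Finset.sum_biUnion (f := fun v => (G.degree v : ℝ)) 𝒞.disjoint
    rw [𝒞.biUnion_parts] at h
    simp only [id] at h
    rw [← Finset.sum_div, ← h, sum_degree]
    exact div_self (by positivity)
  have hCS := sq_sum_le_card_mul_sum_sq (s := 𝒞.parts)
    (f := fun C => (∑ v ∈ C, (G.degree v : ℝ)) / (2 * m))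
  rw [hD] at hCS
  have hS : 0 ≤ ∑ C ∈ 𝒞.parts, ((∑ v ∈ C, (G.degree v : ℝ)) / (2 * m)) ^ 2 :=
    Finset.sum_nonneg fun _ _ => sq_nonneg _
  have h1 : 1 / (Fintype.card V : ℝ)
      ≤ ∑ C ∈ 𝒞.parts, ((∑ v ∈ C, (G.degree v : ℝ)) / (2 * m)) ^ 2 := by
    rw [div_le_iff₀ hV]
    nlinarith
  have h2 : ∑ C ∈ 𝒞.parts,
      ((G.edgeFinset.filter (fun e => ∀ v ∈ e, v ∈ C)).card : ℝ) / m ≤ 1 := by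
    rw [← Finset.sum_div, div_le_one h]
    have : ∑ C ∈ 𝒞.parts, (G.edgeFinset.filter (fun e => ∀ v ∈ e, v ∈ C)).card
        ≤ G.edgeFinset.card := by
      rw [← Finset.card_biUnion]
      · exact Finset.card_le_card (Finset.biUnion_subset.2 fun _ _ => Finset.filter_subset _ _)
      · intro C hC D hD hCD
        refine Finset.disjoint_left.2 ?_
        intro e heC heD
        induction e with
        | _ a b =>
          have h1 := (Finset.mem_filter.1 heC).2 a (by simp)
          have h2 := (Finset.mem_filter.1 heD).2 a (by simp)
          exact hCD (𝒞.eq_of_mem_parts hC hD h1 h2)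
    rw [hmdef]
    exact_mod_cast this
  unfold modularity
  rw [Finset.sum_sub_distrib]
  linarith

lemma exists_modularity_eq_opt (G : SimpleGraph V) [DecidableRel G.Adj] :
    ∃ 𝒞 : Finpartition (Finset.univ : Finset V), modularity G 𝒞 = optModularity G :=
  exists_eq_ciSup_of_finite

lemma sdpFeasible_partition (𝒞 : Finpartition (Finset.univ : Finset V)) :
    SDPFeasible (Matrix.of fun i j => if 𝒞.part i = 𝒞.part j then (1 : ℝ) else 0) := by
  refine ⟨?_, by simp, fun i j => ?_⟩
  · let B : Matrix V (Finset V) ℝ := Matrix.of fun i S => if 𝒞.part i = S then 1 else 0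
    have h : (Matrix.of fun i j => if 𝒞.part i = 𝒞.part j then (1 : ℝ) else 0)
        = B * B.conjTranspose := by
      ext i j
      simp [B, Matrix.mul_apply, eq_comm]
    rw [h]
    exact Matrix.posSemidef_self_mul_conjTranspose B
  · rw [Matrix.of_apply]; split_ifs <;> norm_num

lemma optModularity_le_sdpObjective {X : Matrix V V ℝ} (hX : SDPOptimal G X) :
    optModularity G ≤ sdpObjective G X := by
  obtain ⟨𝒞, h𝒞⟩ := exists_modularity_eq_opt G
  rw [← h𝒞, modularity_eq_sum]
  exact hX.2 _ (sdpFeasible_partition 𝒞)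

end Graph

/-! ### Separation probability of Gaussian hyperplanes. -/

lemma map_inner_pair_stdGaussian {E : Type*} [NormedAddCommGroup E] [InnerProductSpace ℝ E]
    [FiniteDimensional ℝ E] [MeasurableSpace E] [BorelSpace E] {u w : E}
    (hu : ‖u‖ = 1) (hw : ‖w‖ = 1) (huw : inner ℝ u w = 0) :
    (stdGaussian E).map (fun r => ((inner ℝ u r : ℝ), (inner ℝ w r : ℝ)))
      = (gaussianReal 0 1).prod (gaussianReal 0 1) := by
  have hL : (fun r => ((inner ℝ u r : ℝ), (inner ℝ w r : ℝ)))
      = ⇑((innerSL ℝ u).prod (innerSL ℝ w)) := by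
    ext r <;> simp
  rw [hL]
  have : IsProbabilityMeasure ((stdGaussian E).map ⇑((innerSL ℝ u).prod (innerSL ℝ w))) :=
    Measure.isProbabilityMeasure_map (by fun_prop)
  apply Measure.ext_of_charFunDual
  ext M
  rw [charFunDual_map, charFunDual_stdGaussian, charFunDual_prod,
    IsGaussian.charFunDual_eq, IsGaussian.charFunDual_eq]
  -- Characteristic functions are compared: a functional of the pair is an inner product with one
  -- vector, whose squared norm splits by orthonormality.
  have hM : M.comp ((innerSL ℝ u).prod (innerSL ℝ w))
      = innerSL ℝ (M (1, 0) • u + M (0, 1) • w) := by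
    ext r
    have : ((inner ℝ u r : ℝ), (inner ℝ w r : ℝ))
        = (inner ℝ u r : ℝ) • ((1 : ℝ), (0 : ℝ)) + (inner ℝ w r : ℝ) • ((0 : ℝ), (1 : ℝ)) := by
      simp
    simp only [ContinuousLinearMap.comp_apply, ContinuousLinearMap.prod_apply,
      innerSL_apply_apply, inner_add_left, real_inner_smul_left]
    rw [this, map_add, map_smul, map_smul]
    simp [mul_comm]
  have hn : ‖M (1, 0) • u + M (0, 1) • w‖ ^ 2 = M (1, 0) ^ 2 + M (0, 1) ^ 2 := by
    rw [@norm_add_sq_real, real_inner_smul_left, real_inner_smul_right, huw, norm_smul, norm_smul,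
      hu, hw]
    simp
  rw [hM, innerSL_apply_norm]
  have h1 : ∀ N : StrongDual ℝ ℝ, (∫ x, (N x : ℝ) ∂(gaussianReal 0 1)) = 0 ∧
      Var[N; gaussianReal 0 1] = (N 1) ^ 2 := by
    intro N
    have : (N : ℝ → ℝ) = fun x => N 1 * id x := by
      ext x
      have := N.map_smul x 1
      simp only [smul_eq_mul, mul_one] at this
      rw [this, mul_comm]; rfl
    constructor
    · rw [this, integral_const_mul]; simp
    · rw [this, variance_const_mul, variance_id_gaussianReal]; simp
  rw [(h1 _).2, (h1 _).2]
  have h2 : ∀ N : StrongDual ℝ ℝ, (∫ x, ((N x : ℝ) : ℂ) ∂(gaussianReal 0 1)) = 0 := by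
    intro N
    rw [integral_complex_ofReal, (h1 N).1]; simp
  rw [h2, h2, ← Complex.exp_add]
  congr 1
  simp only [ContinuousLinearMap.comp_apply, ContinuousLinearMap.inl_apply,
    ContinuousLinearMap.inr_apply]
  rw [← Complex.ofReal_pow, hn]
  push_cast
  ring

lemma gaussianPDFReal_zero_one_mul (x y : ℝ) :
    gaussianPDFReal 0 1 x * gaussianPDFReal 0 1 y
      = (2 * Real.pi)⁻¹ * Real.exp (-(x ^ 2 + y ^ 2) / 2) := by
  simp only [gaussianPDFReal, NNReal.coe_one, mul_one, sub_zero]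
  rw [mul_mul_mul_comm, ← Real.exp_add, ← mul_inv, Real.mul_self_sqrt (by positivity)]
  congr 2; ring

/-- The radial factor of the planar Gaussian in polar coordinates. -/
lemma lintegral_mul_exp_neg_sq_half :
    ∫⁻ r in Set.Ioi (0 : ℝ), ENNReal.ofReal (r * Real.exp (-r ^ 2 / 2)) = 1 := by
  have hd : ∀ x ∈ Set.Ici (0 : ℝ),
      HasDerivAt (fun r : ℝ => -Real.exp (-r ^ 2 / 2)) (x * Real.exp (-x ^ 2 / 2)) x := by
    intro x _
    have h := (((hasDerivAt_pow 2 x).neg.div_const 2).exp).neg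
    refine h.congr_deriv ?_
    simp only [Pi.neg_apply]
    push_cast
    ring
  have hpos : ∀ x ∈ Set.Ioi (0 : ℝ), 0 ≤ x * Real.exp (-x ^ 2 / 2) := fun x hx =>
    mul_nonneg (le_of_lt hx) (Real.exp_pos _).le
  have hlim : Filter.Tendsto (fun r : ℝ => -Real.exp (-r ^ 2 / 2)) Filter.atTop (nhds 0) := by
    rw [← neg_zero]
    refine (Real.tendsto_exp_atBot.comp ?_).neg
    have : (fun r : ℝ => -r ^ 2 / 2) = fun r => -(r ^ 2 / 2) := by ext; ring
    rw [this]
    exact Filter.tendsto_neg_atTop_atBot.comp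
      ((Filter.tendsto_pow_atTop two_ne_zero).atTop_div_const two_pos)
  have hint := integrableOn_Ioi_deriv_of_nonneg' hd hpos hlim
  rw [← ofReal_integral_eq_lintegral_ofReal hint
    ((ae_restrict_iff' measurableSet_Ioi).2 (Filter.Eventually.of_forall hpos)),
    integral_Ioi_of_hasDerivAt_of_nonneg' hd hpos hlim]
  simp

/-- The probability that a standard Gaussian vector of the plane lies in a cone is the angular
measure of the cone divided by `2π`. -/
lemma gaussianReal_prod_cone {S : Set (ℝ × ℝ)} (hS : MeasurableSet S)
    (hcone : ∀ r : ℝ, 0 < r → ∀ a b : ℝ, (r * a, r * b) ∈ S ↔ (a, b) ∈ S) :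
    ((gaussianReal 0 1).prod (gaussianReal 0 1)) S
      = ENNReal.ofReal (2 * Real.pi)⁻¹
        * volume {t ∈ Set.Ioo (-Real.pi) Real.pi | (Real.cos t, Real.sin t) ∈ S} := by
  rw [gaussianReal_of_var_ne_zero _ one_ne_zero,
    prod_withDensity (measurable_gaussianPDF _ _) (measurable_gaussianPDF _ _),
    withDensity_apply _ hS, ← lintegral_indicator hS, ← Measure.volume_eq_prod,
    ← lintegral_comp_polarCoord_symm]
  set T : Set ℝ := {t | (Real.cos t, Real.sin t) ∈ S} with hT
  have hTm : MeasurableSet T :=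
    (Real.measurable_cos.prodMk Real.measurable_sin) hS
  have hI : ∀ p ∈ polarCoord.target,
      ENNReal.ofReal p.1 • S.indicator
          (fun z : ℝ × ℝ => gaussianPDF 0 1 z.1 * gaussianPDF 0 1 z.2) (polarCoord.symm p)
        = ENNReal.ofReal (p.1 * Real.exp (-p.1 ^ 2 / 2))
          * (ENNReal.ofReal (2 * Real.pi)⁻¹ * T.indicator 1 p.2) := by
    rintro ⟨r, t⟩ ⟨hr, -⟩
    have hr : 0 < r := hr
    simp only [polarCoord_symm_apply]
    by_cases ht : t ∈ T
    · rw [Set.indicator_of_mem ((hcone r hr _ _).2 ht), Set.indicator_of_mem ht]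
      simp only [gaussianPDF, Pi.one_apply, mul_one, smul_eq_mul]
      rw [← ENNReal.ofReal_mul (gaussianPDFReal_nonneg _ _ _), gaussianPDFReal_zero_one_mul,
        ← ENNReal.ofReal_mul hr.le, ← ENNReal.ofReal_mul (by positivity)]
      congr 1
      have : (r * Real.cos t) ^ 2 + (r * Real.sin t) ^ 2 = r ^ 2 := by
        linear_combination r ^ 2 * Real.sin_sq_add_cos_sq t
      rw [this]; ring
    · rw [Set.indicator_of_notMem (fun h => ht ((hcone r hr _ _).1 h)),
        Set.indicator_of_notMem ht]
      simp
  rw [setLIntegral_congr_fun polarCoord.open_target.measurableSet hI, polarCoord_target,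
    Measure.volume_eq_prod, ← Measure.prod_restrict,
    lintegral_prod_mul (f := fun r : ℝ => ENNReal.ofReal (r * Real.exp (-r ^ 2 / 2)))
      (g := fun t => ENNReal.ofReal (2 * Real.pi)⁻¹ * T.indicator 1 t) (by fun_prop)
      ((measurable_const.mul (measurable_one.indicator hTm)).aemeasurable),
    lintegral_mul_exp_neg_sq_half, one_mul, lintegral_const_mul _ (measurable_one.indicator hTm),
    lintegral_indicator_one hTm, Measure.restrict_apply hTm]
  congr 2
  ext t
  simp [hT, and_comm]

/-- Directions t seeing the unit vectors at angles 0 and θ on the same side: what is removed is two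
arcs of length θ, next to -π/2 and π/2. -/
lemma setOf_cos_nonneg_iff_cos_sub_nonneg {θ : ℝ} (h0 : 0 ≤ θ) (h1 : θ ≤ Real.pi / 2) :
    {t ∈ Set.Ioo (-Real.pi) Real.pi | 0 ≤ Real.cos t ↔ 0 ≤ Real.cos (t - θ)}
      = Set.Ioo (-Real.pi) (-(Real.pi / 2)) ∪
        (Set.Icc (θ - Real.pi / 2) (Real.pi / 2) ∪ Set.Ioo (θ + Real.pi / 2) Real.pi) := by
  have hneg : ∀ s : ℝ, Real.pi / 2 < s → s < Real.pi + Real.pi / 2 → Real.cos s < 0 :=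
    fun s => Real.cos_neg_of_pi_div_two_lt_of_lt
  have hneg' : ∀ s : ℝ, s < -(Real.pi / 2) → -(Real.pi + Real.pi / 2) < s → Real.cos s < 0 :=
    fun s hs hs' => by rw [← Real.cos_neg]; exact hneg _ (by linarith) (by linarith)
  have hpos : ∀ s : ℝ, -(Real.pi / 2) ≤ s → s ≤ Real.pi / 2 → 0 ≤ Real.cos s :=
    fun s => Real.cos_nonneg_of_neg_pi_div_two_le_of_le
  ext t
  simp only [Set.mem_union, Set.mem_Ioo, Set.mem_Icc, Set.mem_ofPred_eq]
  constructor
  · rintro ⟨⟨ht1, ht2⟩, h⟩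
    by_cases hA : t < -(Real.pi / 2)
    · exact Or.inl ⟨ht1, hA⟩
    right
    by_cases hB : t < θ - Real.pi / 2
    · exact absurd (h.1 (hpos t (by linarith) (by linarith)))
        (not_le.2 (hneg' _ (by linarith) (by linarith)))
    by_cases hC : t ≤ Real.pi / 2
    · exact Or.inl ⟨by linarith, hC⟩
    right
    by_contra hD
    have : t ≤ θ + Real.pi / 2 := by
      by_contra hE
      exact hD ⟨by linarith, ht2⟩
    exact absurd (h.2 (hpos _ (by linarith) (by linarith)))
      (not_le.2 (hneg t (by linarith) (by linarith)))
  · have hpi := Real.pi_pos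
    rintro (⟨h1, h2⟩ | ⟨h1, h2⟩ | ⟨h1, h2⟩)
    · exact ⟨⟨h1, by linarith⟩, iff_of_false (not_le.2 (hneg' _ h2 (by linarith)))
        (not_le.2 (hneg' _ (by linarith) (by linarith)))⟩
    · exact ⟨⟨by linarith, by linarith⟩, iff_of_true (hpos _ (by linarith) h2)
        (hpos _ (by linarith) (by linarith))⟩
    · exact ⟨⟨by linarith, h2⟩, iff_of_false (not_le.2 (hneg _ (by linarith) (by linarith)))
        (not_le.2 (hneg _ (by linarith) (by linarith)))⟩

lemma volume_cos_nonneg_iff_cos_sub_nonneg {θ : ℝ} (h0 : 0 ≤ θ) (h1 : θ ≤ Real.pi / 2) :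
    volume {t ∈ Set.Ioo (-Real.pi) Real.pi | 0 ≤ Real.cos t ↔ 0 ≤ Real.cos (t - θ)}
      = ENNReal.ofReal (2 * Real.pi - 2 * θ) := by
  have hpi := Real.pi_pos
  rw [setOf_cos_nonneg_iff_cos_sub_nonneg h0 h1, measure_union _
      (measurableSet_Icc.union measurableSet_Ioo), measure_union _ measurableSet_Ioo,
    Real.volume_Ioo, Real.volume_Icc, Real.volume_Ioo,
    ← ENNReal.ofReal_add (by linarith) (by linarith),
    ← ENNReal.ofReal_add (by linarith) (by linarith)]
  · congr 1; ring
  · rw [Set.disjoint_left]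
    rintro t ⟨_, h2⟩ ⟨h3, _⟩
    linarith
  · rw [Set.disjoint_left]
    rintro t ⟨_, h2⟩ (⟨h3, _⟩ | ⟨h3, _⟩) <;> linarith

/-- The probability that a uniformly random hyperplane does not separate two unit vectors. -/
lemma stdGaussian_sameSide {E : Type*} [NormedAddCommGroup E] [InnerProductSpace ℝ E]
    [FiniteDimensional ℝ E] [MeasurableSpace E] [BorelSpace E] {u v : E}
    (hu : ‖u‖ = 1) (hv : ‖v‖ = 1) (huv : 0 ≤ (inner ℝ u v : ℝ)) :
    stdGaussian E {r | 0 ≤ (inner ℝ r u : ℝ) ↔ 0 ≤ (inner ℝ r v : ℝ)}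
      = ENNReal.ofReal (1 - Real.arccos (inner ℝ u v) / Real.pi) := by
  set x : ℝ := inner ℝ u v with hx
  have hx1 : x ≤ 1 := by simpa [hu, hv] using real_inner_le_norm u v
  rcases hx1.eq_or_lt with h1 | h1
  · have : u = v := (inner_eq_one_iff_of_norm_eq_one hu hv).1 h1
    subst this
    simp [h1]
  set θ := Real.arccos x with hθ
  have hcos : Real.cos θ = x := Real.cos_arccos (by linarith) hx1
  have hsin : 0 < Real.sin θ := by
    rw [hθ, Real.sin_arccos]
    exact Real.sqrt_pos.2 (by nlinarith)
  have hsc := Real.sin_sq_add_cos_sq θ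
  have huu : (inner ℝ u u : ℝ) = 1 := by rw [real_inner_self_eq_norm_sq, hu]; norm_num
  have hvv : (inner ℝ v v : ℝ) = 1 := by rw [real_inner_self_eq_norm_sq, hv]; norm_num
  -- Gram–Schmidt reduces the question to the plane of `u` and `v`; the case x = 1 was split off so
  -- that sin θ ≠ 0.
  set w : E := (Real.sin θ)⁻¹ • (v - Real.cos θ • u) with hw
  have huw : (inner ℝ u w : ℝ) = 0 := by
    rw [hw, real_inner_smul_right, inner_sub_right, real_inner_smul_right, huu, ← hx, hcos]
    ring
  have hww : (inner ℝ w w : ℝ) = 1 := by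
    rw [hw, real_inner_smul_right, real_inner_smul_left, inner_sub_right, inner_sub_left,
      inner_sub_left, real_inner_smul_right, real_inner_smul_left, real_inner_smul_right,
      real_inner_smul_left, huu, hvv, real_inner_comm u v, ← hx, hcos]
    rw [hcos] at hsc
    field_simp
    linear_combination -hsc
  have hwn : ‖w‖ = 1 := by
    rw [real_inner_self_eq_norm_sq] at hww
    exact (pow_eq_one_iff_of_nonneg (norm_nonneg w) two_ne_zero).1 hww
  have hv' : v = Real.cos θ • u + Real.sin θ • w := by
    rw [hw, smul_smul, mul_inv_cancel₀ hsin.ne']; simp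
  set S : Set (ℝ × ℝ) := {p | 0 ≤ p.1 ↔ 0 ≤ Real.cos θ * p.1 + Real.sin θ * p.2} with hS
  have hSm : MeasurableSet S :=
    (measurableSet_le measurable_const measurable_fst).iff
      (measurableSet_le measurable_const (by fun_prop))
  have hpre : {r : E | 0 ≤ (inner ℝ r u : ℝ) ↔ 0 ≤ (inner ℝ r v : ℝ)}
      = (fun r => ((inner ℝ u r : ℝ), (inner ℝ w r : ℝ))) ⁻¹' S := by
    ext r
    have : (inner ℝ r v : ℝ) = Real.cos θ * inner ℝ u r + Real.sin θ * inner ℝ w r := by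
      conv_lhs => rw [hv']
      rw [inner_add_right, real_inner_smul_right, real_inner_smul_right, real_inner_comm u,
        real_inner_comm w]
    simp only [Set.mem_ofPred_eq, Set.mem_preimage, hS]
    rw [this, real_inner_comm u r]
  rw [hpre, ← Measure.map_apply (by fun_prop) hSm, map_inner_pair_stdGaussian hu hwn huw,
    gaussianReal_prod_cone hSm]
  · have hT : {t ∈ Set.Ioo (-Real.pi) Real.pi | (Real.cos t, Real.sin t) ∈ S}
        = {t ∈ Set.Ioo (-Real.pi) Real.pi | 0 ≤ Real.cos t ↔ 0 ≤ Real.cos (t - θ)} := by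
      ext t
      simp only [hS, Set.mem_ofPred_eq]
      rw [Real.cos_sub, mul_comm (Real.cos t), mul_comm (Real.sin t)]
    rw [hT, volume_cos_nonneg_iff_cos_sub_nonneg (Real.arccos_nonneg _)
      (Real.arccos_le_pi_div_two.2 huv), ← ENNReal.ofReal_mul (by positivity)]
    congr 1
    rw [← hθ]
    field_simp
  · intro r hr a b
    simp only [hS, Set.mem_ofPred_eq]
    rw [mul_nonneg_iff_of_pos_left hr, show Real.cos θ * (r * a) + Real.sin θ * (r * b)
      = r * (Real.cos θ * a + Real.sin θ * b) by ring, mul_nonneg_iff_of_pos_left hr]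

lemma measurableSet_inner_nonneg_iff {d : ℕ} (a b : EuclideanSpace ℝ (Fin d)) :
    MeasurableSet {s : EuclideanSpace ℝ (Fin d) | 0 ≤ (inner ℝ s a : ℝ) ↔ 0 ≤ (inner ℝ s b : ℝ)} :=
  (measurableSet_le measurable_const (by fun_prop)).iff
    (measurableSet_le measurable_const (by fun_prop))

lemma setOf_sameSide_eq_pi {V : Type*} {d k : ℕ} (u : V → EuclideanSpace ℝ (Fin d)) (i j : V) :
    {r : Fin k → EuclideanSpace ℝ (Fin d) | sameSide u r i j}
      = Set.univ.pi fun _ =>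
        {s | 0 ≤ (inner ℝ s (u i) : ℝ) ↔ 0 ≤ (inner ℝ s (u j) : ℝ)} := by
  ext r
  simp only [Set.mem_pi, Set.mem_univ, true_imp_iff]
  exact Iff.rfl

lemma measurableSet_sameSide {V : Type*} {d k : ℕ} (u : V → EuclideanSpace ℝ (Fin d)) (i j : V) :
    MeasurableSet {r : Fin k → EuclideanSpace ℝ (Fin d) | sameSide u r i j} := by
  rw [setOf_sameSide_eq_pi]
  exact MeasurableSet.univ_pi fun _ => measurableSet_inner_nonneg_iff _ _

instance isProbabilityMeasure_hyperplaneLaw (d k : ℕ) :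
    IsProbabilityMeasure (hyperplaneLaw d k) := by
  unfold hyperplaneLaw; infer_instance

lemma hyperplaneLaw_sameSide {V : Type*} {d k : ℕ} (u : V → EuclideanSpace ℝ (Fin d)) (i j : V)
    (hi : ‖u i‖ = 1) (hj : ‖u j‖ = 1) (hij : 0 ≤ (inner ℝ (u i) (u j) : ℝ)) :
    (hyperplaneLaw d k).real {r | sameSide u r i j} = f k (inner ℝ (u i) (u j)) := by
  rw [measureReal_def, setOf_sameSide_eq_pi, hyperplaneLaw, Measure.pi_pi]
  simp only [stdGaussian_sameSide hi hj hij, Finset.prod_const, Finset.card_univ, Fintype.card_fin,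
    ENNReal.toReal_pow]
  rw [ENNReal.toReal_ofReal, f]
  rw [sub_nonneg, div_le_one Real.pi_pos]
  exact Real.arccos_le_pi _

/-! ### Convexity of f_k and concavity of g_k. -/

/-- The probability `1 - arccos(x)/π` that one random hyperplane does not separate two unit vectors
with inner product `x`. -/
noncomputable def agree (x : ℝ) : ℝ := 1 - Real.arccos x / Real.pi

lemma f_eq (k : ℕ) (x : ℝ) : f k x = agree x ^ k := rfl

lemma agree_nonneg (x : ℝ) : 0 ≤ agree x := by
  rw [agree, sub_nonneg, div_le_one Real.pi_pos]
  exact Real.arccos_le_pi _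

/-- The derivative 1/(π√(1-x²)) increases on (0,1). -/
lemma convexOn_agree : ConvexOn ℝ (Set.Icc 0 1) agree := by
  have hd : ∀ x, deriv agree x = 1 / √(1 - x ^ 2) / Real.pi := by
    intro x
    unfold agree
    rw [deriv_const_sub, deriv_div_const, Real.deriv_arccos]
    ring
  refine MonotoneOn.convexOn_of_deriv (convex_Icc 0 1) ?_ ?_ ?_
  · unfold agree
    exact (continuous_const.sub (Real.continuous_arccos.div_const _)).continuousOn
  · rw [interior_Icc]
    intro x hx
    unfold agree
    exact (((Real.hasDerivAt_arccos (by linarith [hx.1]) hx.2.ne).differentiableAt.div_const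
      _).const_sub _).differentiableWithinAt
  · rw [interior_Icc]
    intro x hx y hy hxy
    rw [hd, hd]
    have : 0 < 1 - y ^ 2 := by nlinarith [hy.1, hy.2]
    gcongr
    exact hx.1.le

lemma convexOn_f (k : ℕ) : ConvexOn ℝ (Set.Icc 0 1) (f k) :=
  convexOn_agree.pow (fun x _ => agree_nonneg x) k

lemma hasDerivAt_f (k : ℕ) {x : ℝ} (h0 : 0 ≤ x) (h1 : x < 1) :
    HasDerivAt (f k) (k * agree x ^ (k - 1) / (Real.pi * Real.sin (Real.arccos x))) x := by
  have h := ((((Real.hasDerivAt_arccos (by linarith) h1.ne).div_const Real.pi).const_sub 1).fun_pow k)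
  refine h.congr_deriv ?_
  rw [Real.sin_arccos, agree]
  field_simp

lemma sin_arccos_pos {x : ℝ} (h0 : 0 ≤ x) (h1 : x < 1) : 0 < Real.sin (Real.arccos x) := by
  rw [Real.sin_arccos]
  exact Real.sqrt_pos.2 (by nlinarith)

/-- The hypothesis says f_k has slope above 1 at x; by convexity the secant from x to z is at least
as steep. -/
lemma g_lt_g_of_deriv_neg {k : ℕ} {x z : ℝ} (h0 : 0 ≤ x) (hxz : x < z) (hz : z ≤ 1)
    (h : Real.pi * Real.sin (Real.arccos x) < k * agree x ^ (k - 1)) : g k z < g k x := by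
  have h1 : x < 1 := by linarith
  have hs := (convexOn_f k).le_slope_of_hasDerivAt ⟨h0, h1.le⟩ ⟨by linarith, hz⟩ hxz
    (hasDerivAt_f k h0 h1)
  have hpos : 0 < Real.pi * Real.sin (Real.arccos x) :=
    mul_pos Real.pi_pos (sin_arccos_pos h0 h1)
  have h2 := ((one_lt_div hpos).2 h).trans_le hs
  rw [slope_def_field, one_lt_div (by linarith)] at h2
  unfold g
  linarith

lemma g_le_g_of_deriv_nonneg {k : ℕ} {x z : ℝ} (h0 : 0 ≤ z) (hxz : z ≤ x) (h1 : x < 1)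
    (h : k * agree x ^ (k - 1) ≤ Real.pi * Real.sin (Real.arccos x)) : g k z ≤ g k x := by
  rcases hxz.eq_or_lt with rfl | hlt
  · exact le_rfl
  have hx0 : 0 ≤ x := by linarith
  have hs := (convexOn_f k).slope_le_of_hasDerivAt ⟨h0, by linarith⟩ ⟨hx0, h1.le⟩ hlt
    (hasDerivAt_f k hx0 h1)
  have hpos : 0 < Real.pi * Real.sin (Real.arccos x) :=
    mul_pos Real.pi_pos (sin_arccos_pos hx0 h1)
  have h2 := hs.trans ((div_le_one hpos).2 h)
  rw [slope_def_field, div_le_one (by linarith)] at h2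
  unfold g
  linarith

/-! ### The crossing point and the best number of hyperplanes. -/

/-- The crossing point of `g 2` and `g 3`. -/
noncomputable def crossing : ℝ := Real.cos ((3 - √5) / 4 * Real.pi)

lemma sqrt_five_bounds : 2.236067 < √5 ∧ √5 < 2.236068 :=
  ⟨Real.lt_sqrt_of_sq_lt (by norm_num), (Real.sqrt_lt' (by norm_num)).2 (by norm_num)⟩

lemma crossing_angle_bounds :
    0.59999 < (3 - √5) / 4 * Real.pi ∧ (3 - √5) / 4 * Real.pi < 0.6 := by
  obtain ⟨h1, h2⟩ := sqrt_five_bounds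
  have h3 := Real.pi_gt_d6
  have h4 := Real.pi_lt_d6
  constructor <;> nlinarith

lemma arccos_crossing : Real.arccos crossing = (3 - √5) / 4 * Real.pi := by
  obtain ⟨h1, h2⟩ := crossing_angle_bounds
  exact Real.arccos_cos (by linarith) (by linarith [Real.pi_gt_three])

lemma agree_crossing : agree crossing = (1 + √5) / 4 := by
  rw [agree, arccos_crossing, mul_div_cancel_right₀ _ Real.pi_ne_zero]
  ring

lemma crossing_pos : 0 < crossing := by
  obtain ⟨h1, h2⟩ := crossing_angle_bounds
  exact Real.cos_pos_of_mem_Ioo ⟨by linarith [Real.pi_gt_three], by linarith [Real.pi_gt_three]⟩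

lemma crossing_lt_one : crossing < 1 := by
  obtain ⟨h1, h2⟩ := crossing_angle_bounds
  have := Real.cos_lt_cos_of_nonneg_of_le_pi le_rfl (by linarith [Real.pi_gt_three])
    (show 0 < (3 - √5) / 4 * Real.pi by linarith)
  rwa [Real.cos_zero] at this

lemma g_two_crossing : g 2 crossing = crossing - (1 + √5) / 8 := by
  have h5 : √5 ^ 2 = 5 := Real.sq_sqrt (by norm_num)
  rw [g, f_eq, agree_crossing]
  linear_combination -h5 / 16

lemma g_three_crossing : g 3 crossing = crossing - (1 + √5) / 8 := by
  have h5 : √5 ^ 2 = 5 := Real.sq_sqrt (by norm_num)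
  rw [g, f_eq, agree_crossing]
  linear_combination (-(√5 + 3) / 64) * h5

lemma agree_mono {x y : ℝ} (h : x ≤ y) : agree x ≤ agree y := by
  unfold agree
  have := Real.arccos_le_arccos h
  have := Real.pi_pos
  gcongr

lemma agree_lower {x : ℝ} (h : crossing ≤ x) : 0.809 < agree x := by
  have := agree_mono h
  rw [agree_crossing] at this
  linarith [sqrt_five_bounds.1]

lemma agree_lt_one {x : ℝ} (h : x < 1) : agree x < 1 :=
  sub_lt_self _ (div_pos (Real.arccos_pos.2 h) Real.pi_pos)

lemma arccos_eq_pi_mul (x : ℝ) : Real.arccos x = Real.pi * (1 - agree x) := by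
  rw [agree]
  field_simp
  ring

/-- If `K ≥ 3` hyperplanes are no worse than `K - 1` at `x`, then `g K` is decreasing at `x`. -/
lemma deriv_g_neg {x : ℝ} (hc : crossing ≤ x) (h1 : x < 1) {k : ℕ} (hk : 2 ≤ k)
    (h : 2 * (1 - agree x) * (2 * agree x) ^ k ≤ 1) :
    Real.pi * Real.sin (Real.arccos x) < (k + 1 : ℕ) * agree x ^ (k + 1 - 1) := by
  have ha := agree_lower hc
  have ha1 := agree_lt_one h1
  -- With a = `agree x`, sin θ ≤ θ = π(1-a) leaves π²(1-a) < (k+1)a^k. Multiplying by 2(2a)^k and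
  -- using `h`, it suffices that π² < 2(k+1)(2a²)^k, which k ≥ 2 and a > 0.809 ensure.
  have hsin : Real.sin (Real.arccos x) ≤ Real.pi * (1 - agree x) := by
    rw [← arccos_eq_pi_mul]
    exact Real.sin_le (Real.arccos_nonneg x)
  set a := agree x
  have hpi := Real.pi_pos
  have hpi2 : Real.pi ^ 2 < 10 := by nlinarith [Real.pi_lt_d2]
  have hle : Real.pi * Real.sin (Real.arccos x) ≤ Real.pi ^ 2 * (1 - a) := by
    have := mul_le_mul_of_nonneg_left hsin hpi.le
    nlinarith
  refine hle.trans_lt ?_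
  rw [Nat.add_sub_cancel]
  have hP : 0 < 2 * (2 * a) ^ k := by positivity
  have hpow : (1.711 : ℝ) ≤ (2 * a ^ 2) ^ k :=
    calc (1.711 : ℝ) ≤ (1.3089 : ℝ) ^ 2 := by norm_num
      _ ≤ (2 * a ^ 2) ^ 2 := by
        have : (1.3089 : ℝ) ≤ 2 * a ^ 2 := by nlinarith
        gcongr
      _ ≤ (2 * a ^ 2) ^ k := pow_le_pow_right₀ (by nlinarith) hk
  have hk' : (3 : ℝ) ≤ (k + 1 : ℕ) := by exact_mod_cast Nat.succ_le_succ hk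
  refine lt_of_mul_lt_mul_right ?_ hP.le
  have e1 : a ^ k * (2 * (2 * a) ^ k) = 2 * (2 * a ^ 2) ^ k := by
    rw [mul_left_comm, ← mul_pow]; ring_nf
  calc Real.pi ^ 2 * (1 - a) * (2 * (2 * a) ^ k)
      = Real.pi ^ 2 * (2 * (1 - a) * (2 * a) ^ k) := by ring
    _ ≤ Real.pi ^ 2 * 1 := by gcongr
    _ < 3 * (2 * 1.711) := by linarith
    _ ≤ (k + 1 : ℕ) * (2 * (2 * a ^ 2) ^ k) := by gcongr
    _ = (k + 1 : ℕ) * a ^ k * (2 * (2 * a) ^ k) := by rw [mul_assoc, e1]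

/-- By `g_succ_sub_g` this means g_3 ≤ g_2 from the crossing on: t²(1-t) decreases for t ≥ 2/3, and
8t²(1-t) = 1 at t = (1+√5)/4. -/
lemma agree_sq_mul_le {x : ℝ} (hc : crossing ≤ x) :
    2 * (1 - agree x) * (2 * agree x) ^ 2 ≤ 1 := by
  have ha := agree_mono hc
  have ha2 := agree_lower hc
  rw [agree_crossing] at ha
  have h5 : √5 ^ 2 = 5 := Real.sq_sqrt (by norm_num)
  obtain ⟨hl, hu⟩ := sqrt_five_bounds
  set a := agree x
  set b := (1 + √5) / 4 with hb
  have hb1 : 8 * b ^ 2 * (1 - b) = 1 := by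
    rw [hb]; linear_combination (1 / 8 - √5 / 8) * h5
  have hb2 : 0.809 < b := by rw [hb]; linarith
  nlinarith [mul_nonneg (sub_nonneg.2 ha) (show 0 ≤ a ^ 2 + a * b + b ^ 2 - a - b by nlinarith)]

/-- Two or three hyperplanes always suffice for the bound at the crossing point. -/
lemma exists_g_le_crossing {z : ℝ} (h0 : 0 ≤ z) (h1 : z ≤ 1) (n : ℕ) :
    ∃ l ∈ admissible n, g l z ≤ crossing - (1 + √5) / 8 := by
  rcases le_or_gt z crossing with h | h
  · refine ⟨2, ?_, ?_⟩
    · simp [admissible]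
    · rw [← g_two_crossing]
      refine g_le_g_of_deriv_nonneg h0 h crossing_lt_one ?_
      rw [agree_crossing, arccos_crossing]
      obtain ⟨h1, h2⟩ := crossing_angle_bounds
      set y := (3 - √5) / 4 * Real.pi
      -- The claim is (1+√5)/2 ≤ π sin y with y close to 0.6; a cubic lower bound for the sine and π
      -- > 3 are enough.
      have hs := Real.sin_gt_sub_cube (x := y) (by linarith)
      have hy : y ^ 3 < 0.6 ^ 3 := by gcongr
      have := Real.pi_gt_three
      have := sqrt_five_bounds.2
      norm_num at hy ⊢
      nlinarith
  · refine ⟨3, ?_, ?_⟩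
    · simp [admissible]
    · rw [← g_three_crossing]
      exact (g_lt_g_of_deriv_neg crossing_pos.le h h1
        (deriv_g_neg le_rfl crossing_lt_one le_rfl (agree_sq_mul_le le_rfl))).le

/-- For 1/2 < `agree x` < 1 the numerator increases with k, so g_k(x) first decreases and then
increases in k. -/
lemma g_succ_sub_g (k : ℕ) (x : ℝ) :
    g (k + 1) x - g k x = (2 * (1 - agree x) * (2 * agree x) ^ k - 1) / 2 ^ (k + 1) := by
  simp only [g, f_eq, mul_pow, pow_succ]
  field_simp
  ring

lemma mem_admissible_of_lt {n k : ℕ} (h : (2 : ℝ) ^ k < n) : k + 1 ∈ admissible n := by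
  rw [admissible, Finset.mem_Icc]
  refine ⟨by omega, le_max_of_le_right ?_⟩
  rw [Nat.succ_le_iff, Nat.lt_ceil, Real.lt_logb_iff_rpow_lt (by norm_num), Real.rpow_natCast]
  · exact h
  · exact lt_trans (by positivity) h

/-- With a = `agree x`, 1 - θ²/2 ≤ cos θ = x gives 1/n ≤ π²(1-a)²/2 < 5(1-a)². Squaring `h` and
using (2a²)^k ≥ 2, true from k = 3 on, gives 2^k (1-a)² < 1/8. Together 2^k / n < 1. -/
lemma two_pow_lt_of_le_one_sub_inv {x : ℝ} {n k : ℕ} (hc : crossing ≤ x) (h1 : x < 1)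
    (hn : 0 < n) (hx : x ≤ 1 - 1 / (n : ℝ)) (hk : 3 ≤ k)
    (h : 2 * (1 - agree x) * (2 * agree x) ^ k < 1) : (2 : ℝ) ^ k < n := by
  have ha := agree_lower hc
  have ha1 := agree_lt_one h1
  have hcos : 1 - (Real.pi * (1 - agree x)) ^ 2 / 2 ≤ x := by
    rw [← arccos_eq_pi_mul]
    conv_rhs => rw [← Real.cos_arccos (x := x) (by linarith [crossing_pos]) h1.le]
    exact Real.one_sub_sq_div_two_le_cos
  set a := agree x
  have hn' : (0 : ℝ) < n := by exact_mod_cast hn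
  have hpi2 : Real.pi ^ 2 < 10 := by nlinarith [Real.pi_lt_d2, Real.pi_pos]
  have hpow : (2 : ℝ) ≤ (2 * a ^ 2) ^ k :=
    calc (2 : ℝ) ≤ (1.3 : ℝ) ^ 3 := by norm_num
      _ ≤ (2 * a ^ 2) ^ 3 := by
        have : (1.3 : ℝ) ≤ 2 * a ^ 2 := by nlinarith
        gcongr
      _ ≤ (2 * a ^ 2) ^ k := pow_le_pow_right₀ (by nlinarith) hk
  have hnn : 0 ≤ 2 * (1 - a) * (2 * a) ^ k :=
    mul_nonneg (by linarith) (pow_nonneg (by linarith) _)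
  have hsq : (2 * (1 - a) * (2 * a) ^ k) ^ 2 < 1 := by nlinarith
  have e : (2 * (1 - a) * (2 * a) ^ k) ^ 2 = 4 * ((2 : ℝ) ^ k * (1 - a) ^ 2) * (2 * a ^ 2) ^ k := by
    rw [mul_pow, mul_pow, ← pow_mul, mul_comm k 2, pow_mul,
      show (2 * a) ^ 2 = 2 * (2 * a ^ 2) by ring, mul_pow]
    ring
  have hD : 0 ≤ (2 : ℝ) ^ k * (1 - a) ^ 2 := by positivity
  rw [e] at hsq
  have h8 : (2 : ℝ) ^ k * (1 - a) ^ 2 < 1 / 8 := by nlinarith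
  have hinv : 1 / (n : ℝ) ≤ Real.pi ^ 2 * (1 - a) ^ 2 / 2 := by rw [mul_pow] at hcos; linarith
  have hpk : (0 : ℝ) < 2 ^ k := by positivity
  have : (2 : ℝ) ^ k * (1 / n) < 1 := by
    have := mul_le_mul_of_nonneg_left hinv hpk.le
    nlinarith
  rw [mul_one_div, div_lt_one hn'] at this
  exact this

/-- Above the crossing point, the best number of hyperplanes is admissible and yields a strictly
smaller loss at every larger point. -/
lemma exists_admissible_minimizer {x z : ℝ} {n : ℕ} (hc : crossing ≤ x) (hn : 0 < n)
    (hx : x ≤ 1 - 1 / (n : ℝ)) (hxz : x < z) (hz : z ≤ 1) :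
    ∃ K ∈ admissible n, (∀ l, 1 ≤ l → g K x ≤ g l x) ∧ g K z < g K x := by
  have h1 : x < 1 := by linarith
  have ha := agree_lower hc
  have ha1 := agree_lt_one h1
  have hmono : ∀ k l : ℕ, k ≤ l → 2 * (1 - agree x) * (2 * agree x) ^ k
      ≤ 2 * (1 - agree x) * (2 * agree x) ^ l := fun k l hkl =>
    mul_le_mul_of_nonneg_left (pow_le_pow_right₀ (by linarith) hkl) (by linarith)
  -- The least such k is the minimiser. Starting at 3 loses nothing, since g_3 ≤ g_2 ≤ g_1 here, and
  -- it provides the three hyperplanes that `deriv_g_neg` needs.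
  have hex : ∃ k : ℕ, 3 ≤ k ∧ 1 ≤ 2 * (1 - agree x) * (2 * agree x) ^ k := by
    obtain ⟨k, hk⟩ := pow_unbounded_of_one_lt (1 / (2 * (1 - agree x)))
      (show 1 < 2 * agree x by linarith)
    rw [div_lt_iff₀ (by linarith), mul_comm] at hk
    exact ⟨max 3 k, le_max_left _ _, hk.le.trans (hmono _ _ (le_max_right _ _))⟩
  classical
  obtain ⟨hK3, hK⟩ := Nat.find_spec hex
  have hmin := fun m (hm : m < Nat.find hex) => Nat.find_min hex hm
  set K := Nat.find hex
  have hbelow : ∀ k, k < K → 2 * (1 - agree x) * (2 * agree x) ^ k ≤ 1 := by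
    intro k hk
    by_cases h3 : 3 ≤ k
    · have := hmin k hk
      rw [not_and, not_le] at this
      exact (this h3).le
    · exact (hmono k 2 (by omega)).trans (agree_sq_mul_le hc)
  obtain ⟨k, hk⟩ : ∃ k, K = k + 1 := ⟨K - 1, by omega⟩
  refine ⟨K, ?_, ?_, ?_⟩
  · by_cases h3 : 3 ≤ k
    · rw [hk]
      have := hmin k (by omega)
      rw [not_and, not_le] at this
      exact mem_admissible_of_lt (two_pow_lt_of_le_one_sub_inv hc h1 hn hx h3 (this h3))
    · rw [admissible, Finset.mem_Icc]
      exact ⟨by omega, le_max_of_le_left (by omega)⟩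
  · intro l _
    rcases le_total K l with hl | hl
    · induction l, hl using Nat.le_induction with
      | base => exact le_rfl
      | succ l hl ih =>
        have h2 : 0 ≤ g (l + 1) x - g l x := by
          rw [g_succ_sub_g]
          exact div_nonneg (by linarith [hmono K l hl]) (by positivity)
        linarith [ih (by omega)]
    · refine Nat.decreasingInduction' (P := fun l => g K x ≤ g l x) (fun j hj _ ih => ?_) hl le_rfl
      have h2 : g (j + 1) x - g j x ≤ 0 := by
        rw [g_succ_sub_g]
        exact div_nonpos_of_nonpos_of_nonneg (by linarith [hbelow j hj]) (by positivity)
      linarith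
  · have := deriv_g_neg hc h1 (show 2 ≤ k by omega) (hbelow k (by omega))
    rw [← hk] at this
    exact g_lt_g_of_deriv_neg (crossing_pos.le.trans hc) hxz hz this

lemma cos_two_mul_le {t b : ℝ} (h0 : 0 ≤ Real.cos t) (hb : Real.cos t ≤ b) :
    Real.cos (2 * t) ≤ 2 * b ^ 2 - 1 := by
  rw [Real.cos_two_mul]
  nlinarith

lemma crossing_bound : crossing - (1 + √5) / 8 < 0.42084 := by
  obtain ⟨h1, h2⟩ := crossing_angle_bounds
  have hc : crossing ≤ Real.cos 0.59999 :=
    Real.cos_le_cos_of_nonneg_of_le_pi (by norm_num) (by linarith [Real.pi_gt_three]) h1.le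
  have hpos : ∀ t : ℝ, 0 ≤ t → t ≤ 1 → 0 ≤ Real.cos t := fun t ht ht1 =>
    Real.cos_nonneg_of_neg_pi_div_two_le_of_le (by linarith [Real.pi_gt_three])
      (by linarith [Real.pi_gt_three])
  -- At 1/64 of the angle the quartic Taylor error is negligible, even after the six angle doublings
  -- that lead back to 0.59999.
  have b0 : Real.cos (0.59999 / 64) ≤ 0.9999560567 := by
    have := (abs_le.1 (Real.cos_bound (x := 0.59999 / 64) (by norm_num [abs_of_pos]))).2
    norm_num [abs_of_pos] at this ⊢
    linarith
  have step : ∀ t b b' : ℝ, 0 ≤ t → t ≤ 1 → Real.cos t ≤ b → 2 * b ^ 2 - 1 ≤ b' →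
      Real.cos (2 * t) ≤ b' := fun t b b' h0 h1 hb hb' =>
    (cos_two_mul_le (hpos t h0 h1) hb).trans hb'
  have b1 := step _ _ 0.9998242307 (by norm_num) (by norm_num) b0 (by norm_num)
  have b2 := step _ _ 0.9992969846 (by norm_num) (by norm_num) b1 (by norm_num)
  have b3 := step _ _ 0.9971889269 (by norm_num) (by norm_num) b2 (by norm_num)
  have b4 := step _ _ 0.9887715119 (by norm_num) (by norm_num) b3 (by norm_num)
  have b5 := step _ _ 0.9553382055 (by norm_num) (by norm_num) b4 (by norm_num)
  have b6 := step _ _ 0.8253421738 (by norm_num) (by norm_num) b5 (by norm_num)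
  rw [show (2 * (2 * (2 * (2 * (2 * (2 * (0.59999 / 64)))))) : ℝ) = 0.59999 by norm_num] at b6
  linarith [sqrt_five_bounds.1]

/-! ### Expected modularity of the rounded partition. -/

section Rounding

variable {V : Type*} [Fintype V] [DecidableEq V] {d k : ℕ}

lemma hyperplanePartition_part_eq_iff (u : V → EuclideanSpace ℝ (Fin d))
    (r : Fin k → EuclideanSpace ℝ (Fin d)) (i j : V) :
    (hyperplanePartition u r).part i = (hyperplanePartition u r).part j ↔ sameSide u r i j := by
  classical
  rw [← Finpartition.mem_part_iff_part_eq_part _ (Finset.mem_univ i) (Finset.mem_univ j),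
    hyperplanePartition, Finpartition.mem_part_ofSetoid_iff_rel]
  exact ⟨(sameSide u r).symm', (sameSide u r).symm'⟩

lemma modularity_hyperplanePartition (G : SimpleGraph V) [DecidableRel G.Adj]
    (u : V → EuclideanSpace ℝ (Fin d)) (r : Fin k → EuclideanSpace ℝ (Fin d)) :
    modularity G (hyperplanePartition u r)
      = ∑ p : V × V, qCoeff G p.1 p.2 * {r | sameSide u r p.1 p.2}.indicator 1 r := by
  classical
  rw [modularity_eq_sum]
  refine Finset.sum_congr rfl fun p _ => ?_
  simp [hyperplanePartition_part_eq_iff, Set.indicator_apply]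

omit [Fintype V] [DecidableEq V] in
lemma integrable_indicator_sameSide (u : V → EuclideanSpace ℝ (Fin d)) (c : ℝ) (i j : V) :
    Integrable (fun r => c * {r | sameSide u r i j}.indicator 1 r)
      (hyperplaneLaw d k) :=
  ((integrable_const (1 : ℝ)).indicator (measurableSet_sameSide u i j)).const_mul c

lemma integrable_modularity_hyperplanePartition (G : SimpleGraph V) [DecidableRel G.Adj]
    (u : V → EuclideanSpace ℝ (Fin d)) :
    Integrable (fun r => modularity G (hyperplanePartition u r)) (hyperplaneLaw d k) := by
  simp only [modularity_hyperplanePartition]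
  exact integrable_finsetSum _ fun p _ => integrable_indicator_sameSide u _ _ _

lemma expectedModularity_eq (G : SimpleGraph V) [DecidableRel G.Adj]
    {X : Matrix V V ℝ} (hX : SDPFeasible X) (u : V → EuclideanSpace ℝ (Fin d))
    (hu : ∀ i j, inner ℝ (u i) (u j) = X i j) (k : ℕ) :
    expectedModularity G u k = ∑ p : V × V, qCoeff G p.1 p.2 * f k (X p.1 p.2) := by
  have hn : ∀ i, ‖u i‖ = 1 := fun i => by
    have := hu i i
    rw [hX.2.1 i, real_inner_self_eq_norm_sq] at this
    exact (pow_eq_one_iff_of_nonneg (norm_nonneg _) two_ne_zero).1 this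
  simp only [expectedModularity, modularity_hyperplanePartition]
  rw [integral_finsetSum _ fun p _ => integrable_indicator_sameSide u _ _ _]
  refine Finset.sum_congr rfl fun p _ => ?_
  rw [integral_const_mul, integral_indicator_one (measurableSet_sameSide u _ _),
    hyperplaneLaw_sameSide u _ _ (hn _) (hn _) (by rw [hu]; exact hX.2.2 _ _), hu]

omit [Fintype V] [DecidableEq V] in
lemma entry_le_one {X : Matrix V V ℝ} (hX : SDPFeasible X) {u : V → EuclideanSpace ℝ (Fin d)}
    (hu : ∀ i j, inner ℝ (u i) (u j) = X i j) (i j : V) : X i j ≤ 1 := by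
  have h := real_inner_mul_inner_self_le (u i) (u j)
  rw [hu, hu, hu, hX.2.1, hX.2.1] at h
  nlinarith

end Rounding

/-! ### The loss bound q g_k(z₊). -/

section Bound

variable {V : Type*} [Fintype V] [DecidableEq V] {G : SimpleGraph V} [DecidableRel G.Adj]

lemma qTotal_mul_zPlus (hm : 0 < G.edgeFinset.card) (X : Matrix V V ℝ) :
    qTotal G * zPlus G X = ∑ p ∈ nonnegPairs G, qCoeff G p.1 p.2 * X p.1 p.2 := by
  rw [zPlus, ← mul_assoc, mul_one_div_cancel (qTotal_pos hm).ne', one_mul]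

lemma zPlus_nonneg (hm : 0 < G.edgeFinset.card) {X : Matrix V V ℝ} (hX : ∀ i j, 0 ≤ X i j) :
    0 ≤ zPlus G X :=
  mul_nonneg (one_div_nonneg.2 (qTotal_pos hm).le)
    (Finset.sum_nonneg fun _ hp => mul_nonneg (mem_nonnegPairs.1 hp) (hX _ _))

lemma zPlus_le_one (hm : 0 < G.edgeFinset.card) {X : Matrix V V ℝ} (hX : ∀ i j, X i j ≤ 1) :
    zPlus G X ≤ 1 := by
  rw [zPlus, one_div_mul_eq_div, div_le_one (qTotal_pos hm)]
  exact Finset.sum_le_sum fun p hp => mul_le_of_le_one_right (mem_nonnegPairs.1 hp) (hX _ _)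

/-- Jensen's inequality with weights q_ij / q, whose weighted mean is z₊. -/
lemma qTotal_mul_f_zPlus_le (hm : 0 < G.edgeFinset.card) {X : Matrix V V ℝ}
    (hX0 : ∀ i j, 0 ≤ X i j) (hX1 : ∀ i j, X i j ≤ 1) (k : ℕ) :
    qTotal G * f k (zPlus G X) ≤ ∑ p ∈ nonnegPairs G, qCoeff G p.1 p.2 * f k (X p.1 p.2) := by
  have hq := qTotal_pos hm
  have h := (convexOn_f k).map_sum_le (t := nonnegPairs G)
    (w := fun p => qCoeff G p.1 p.2 / qTotal G) (p := fun p => X p.1 p.2)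
    (fun p hp => div_nonneg (mem_nonnegPairs.1 hp) hq.le)
    (by rw [← Finset.sum_div]; exact div_self hq.ne') (fun p _ => ⟨hX0 _ _, hX1 _ _⟩)
  have e : ∀ y : V × V → ℝ, ∑ p ∈ nonnegPairs G, (qCoeff G p.1 p.2 / qTotal G) • y p
      = (∑ p ∈ nonnegPairs G, qCoeff G p.1 p.2 * y p) / qTotal G := by
    intro y
    rw [Finset.sum_div]
    exact Finset.sum_congr rfl fun p _ => by rw [smul_eq_mul]; ring
  rw [e, e, le_div_iff₀ hq] at h
  rw [zPlus, one_div_mul_eq_div, mul_comm]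
  exact h

/-- Convexity between the endpoint values 2^{-k} at 0 and 1 at 1. -/
lemma f_le_chord (k : ℕ) {x : ℝ} (h0 : 0 ≤ x) (h1 : x ≤ 1) :
    f k x ≤ x + (1 - x) / 2 ^ k := by
  have h := (convexOn_f k).2 (Set.left_mem_Icc.2 zero_le_one) (Set.right_mem_Icc.2 zero_le_one)
    (sub_nonneg.2 h1) h0 (sub_add_cancel 1 x)
  have f0 : f k 0 = 1 / 2 ^ k := by
    rw [f, Real.arccos_zero, div_right_comm, div_self Real.pi_ne_zero]
    rw [← one_div_pow]
    norm_num only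
  have f1 : f k 1 = 1 := by simp [f]
  simp only [smul_eq_mul, mul_zero, mul_one, zero_add, f0, f1] at h
  linarith [mul_one_div (1 - x) ((2 : ℝ) ^ k)]

/-- Rounding with `k` hyperplanes loses at most `q g_k(z₊)`. -/
lemma sdpObjective_sub_le (hm : 0 < G.edgeFinset.card) {X : Matrix V V ℝ}
    (hX0 : ∀ i j, 0 ≤ X i j) (hX1 : ∀ i j, X i j ≤ 1) (k : ℕ) :
    sdpObjective G X - qTotal G * g k (zPlus G X)
      ≤ ∑ p : V × V, qCoeff G p.1 p.2 * f k (X p.1 p.2) := by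
  rw [sdpObjective, ← Finset.sum_add_sum_compl (nonnegPairs G),
    ← Finset.sum_add_sum_compl (nonnegPairs G) (fun p => qCoeff G p.1 p.2 * f k (X p.1 p.2)),
    ← qTotal_mul_zPlus hm]
  have h1 := qTotal_mul_f_zPlus_le hm hX0 hX1 k
  have h2 : ∑ p ∈ (nonnegPairs G)ᶜ,
      (qCoeff G p.1 p.2 * X p.1 p.2 + qCoeff G p.1 p.2 * (1 / 2 ^ k))
      ≤ ∑ p ∈ (nonnegPairs G)ᶜ, qCoeff G p.1 p.2 * f k (X p.1 p.2) := by
    refine Finset.sum_le_sum fun p hp => ?_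
    rw [Finset.mem_compl, mem_nonnegPairs, not_le] at hp
    rw [← mul_add]
    refine mul_le_mul_of_nonpos_left ((f_le_chord k (hX0 _ _) (hX1 _ _)).trans ?_) hp.le
    have := hX0 p.1 p.2
    gcongr
    linarith
  rw [Finset.sum_add_distrib, ← Finset.sum_mul, sum_qCoeff_neg hm] at h2
  unfold g
  linarith

lemma sdpObjective_le (hm : 0 < G.edgeFinset.card) {X : Matrix V V ℝ} (hX0 : ∀ i j, 0 ≤ X i j) :
    sdpObjective G X ≤ qTotal G * zPlus G X := by
  rw [sdpObjective, ← Finset.sum_add_sum_compl (nonnegPairs G), ← qTotal_mul_zPlus hm,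
    add_le_iff_nonpos_right]
  refine Finset.sum_nonpos fun p hp => mul_nonpos_of_nonpos_of_nonneg ?_ (hX0 _ _)
  rw [Finset.mem_compl, mem_nonnegPairs, not_le] at hp
  exact hp.le

end Bound

end ModularityMax

/-! ### The two guarantees. -/

theorem mainTheorem1 {V : Type*} [Fintype V] [DecidableEq V]
    (G : SimpleGraph V) [DecidableRel G.Adj] (hm : 0 < G.edgeFinset.card)
    (X : Matrix V V ℝ) (hX : ModularityMax.SDPOptimal G X)
    {d : ℕ} (u : V → EuclideanSpace ℝ (Fin d)) (hu : ∀ i j, inner ℝ (u i) (u j) = X i j)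
    (k : ℕ) (hk : ModularityMax.IsArgminG (Fintype.card V) (ModularityMax.zPlus G X) k) :
    MeasureTheory.Integrable
        (fun r => ModularityMax.modularity G (ModularityMax.hyperplanePartition u r))
        (ModularityMax.hyperplaneLaw d k) ∧
      ModularityMax.optModularity G
          - ModularityMax.qTotal G
            * (Real.cos ((3 - Real.sqrt 5) / 4 * Real.pi) - (1 + Real.sqrt 5) / 8)
        ≤ ModularityMax.expectedModularity G u k ∧
      (Real.cos ((3 - Real.sqrt 5) / 4 * Real.pi) ≤ ModularityMax.optModularity G →
        ∃ μ : ℝ,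
          IsLeast {y : ℝ | ∃ l : ℕ, 1 ≤ l ∧
            y = ModularityMax.g l (ModularityMax.optModularity G)} μ ∧
          ModularityMax.optModularity G - ModularityMax.qTotal G * μ
            < ModularityMax.expectedModularity G u k) ∧
      ModularityMax.qTotal G < 1 ∧
      Real.cos ((3 - Real.sqrt 5) / 4 * Real.pi) - (1 + Real.sqrt 5) / 8 < 0.42084 := by
  open ModularityMax in
  have hX0 := hX.1.2.2
  have hX1 := entry_le_one hX.1 hu
  have hq := qTotal_pos hm
  have hq1 := qTotal_lt_one hm
  have hopt := optModularity_le_sdpObjective hX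
  have hz0 := zPlus_nonneg (G := G) hm hX0
  have hz1 := zPlus_le_one hm hX1
  have hmain : optModularity G - qTotal G * g k (zPlus G X) ≤ expectedModularity G u k := by
    rw [expectedModularity_eq G hX.1 u hu]
    linarith [sdpObjective_sub_le hm hX0 hX1 k]
  refine ⟨integrable_modularity_hyperplanePartition G u, ?_, fun hc => ?_, hq1, crossing_bound⟩
  · obtain ⟨l, hl, hlz⟩ := exists_g_le_crossing hz0 hz1 (Fintype.card V)
    have := mul_le_mul_of_nonneg_left ((hk.2 l hl).trans hlz) hq.le
    exact le_trans (sub_le_sub_left this _) hmain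
  · have hcard : 0 < Fintype.card V := by
      obtain ⟨i, _⟩ := exists_adj hm
      exact Fintype.card_pos_iff.2 ⟨i⟩
    have hle : optModularity G ≤ 1 - 1 / (Fintype.card V : ℝ) := by
      obtain ⟨𝒞, h𝒞⟩ := exists_modularity_eq_opt G
      rw [← h𝒞]
      exact modularity_le hm 𝒞
    have hqz := hopt.trans (sdpObjective_le hm hX0)
    have hpos : 0 < optModularity G := crossing_pos.trans_le hc
    -- Strictness in the second guarantee comes from here: OPT ≤ q z₊ with q < 1 and z₊ > 0.
    have hlt : optModularity G < zPlus G X := by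
      have hz : 0 < zPlus G X := pos_of_mul_pos_right (hpos.trans_le hqz) hq.le
      exact hqz.trans_lt (mul_lt_of_lt_one_left hz hq1)
    obtain ⟨K, hK, hKmin, hKlt⟩ := exists_admissible_minimizer hc hcard hle hlt hz1
    refine ⟨g K (optModularity G), ⟨⟨K, (Finset.mem_Icc.1 hK).1, rfl⟩, ?_⟩, ?_⟩
    · rintro y ⟨l, hl, rfl⟩
      exact hKmin l hl
    · have := mul_lt_mul_of_pos_left ((hk.2 K hK).trans_lt hKlt) hq
      linarith
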